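/- Let $X$ be a compact Hausdorff, path-connected, locally path-connected topological space admitting a universal cover, and let $\mathfrak a\in H^1(X;\mathbb R)$ be a singular cohomology class. Let $\operatorname{Homeo}(X,\mathfrak a)$ be the group of homeomorphisms $f$ of $X$ with $f^*\mathfrak a=\mathfrak a$. For a point $x\in X$ and a singular cocycle $\alpha$ representing $\mathfrak a$, the formula $$\mathfrak G_{x,\alpha}(g,h)=\int_\gamma (g^*\alpha-\alpha),\qquad \gamma \text{ any path from } x \text{ to } h(x),$$ (where $\int_\gamma$ is the pairing of cochains with chains) defines a two-cocycle on $\operatorname{Homeo}(X,\mathfrak a)$, whose class $[\mathfrak G]\in H^2(B\operatorname{Homeo}(X,\mathfrak a)^\delta;\mathbb R)$ (the second cohomology of the underlying discrete group with trivial coefficients) does not depend on $x$ and $\alpha$. A topological group $G$ is called amenable if every continuous affine action of $G$ on a non-empty compact convex subset of a (Hausdorff) locally convex topological vector space has a fixed point. Let $G$ be an amenable topological group and let $\psi\colon G\to\operatorname{Homeo}(X,\mathfrak a)$ be an action, that is, a homomorphism such that $(g,y)\mapsto\psi(g)(y)$ is continuous on $G\times X$. Then $\psi$ preserves a Borel probability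 measure on $X$, and $$\psi^*[\mathfrak G]=0\quad\text{in } H^2(BG^\delta;\mathbb R),$$ where $G^\delta$ is $G$ with the discrete topology; that is, $\psi^*[\mathfrak G_{x,\alpha}]=0$ for every $x\in X$ and every singular cocycle $\alpha$ representing $\mathfrak a$. -/

import Mathlib

universe u v w

noncomputable section

/-! ### Singular cochains and the first singular cohomology group -/

/-- Singular `n`-simplices of `X`. -/
abbrev SingularSimplex (n : ℕ) (X : Type u) [TopologicalSpace X] : Type u :=
  C(stdSimplex ℝ (Fin (n + 1)), X)

namespace SingularSimplex

variable {X : Type u} [TopologicalSpace X]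

/-- The `i`-th face of a singular simplex. -/
def face {n : ℕ} (i : Fin (n + 2)) (σ : SingularSimplex (n + 1) X) : SingularSimplex n X :=
  σ.comp ⟨stdSimplex.map i.succAbove, stdSimplex.continuous_map _⟩

/-- The singular `0`-simplex at a point. -/
def point (x : X) : SingularSimplex 0 X := ContinuousMap.const _ x

/-- A path from `x` to `y`, seen as a singular `1`-simplex with vertices `x`, `y` (in this
order). -/
def ofPath {x y : X} (γ : Path x y) : SingularSimplex 1 X :=
  γ.toContinuousMap.comp ⟨stdSimplexHomeomorphUnitInterval,
    stdSimplexHomeomorphUnitInterval.continuous⟩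

theorem face_zero_ofPath {x y : X} (γ : Path x y) : face 0 (ofPath γ) = point y := by
  ext s
  have hs : stdSimplex.map (0 : Fin 2).succAbove s = stdSimplex.vertex (S := ℝ) 1 := by
    rw [Subsingleton.elim s (stdSimplex.vertex 0), stdSimplex.map_vertex]; rfl
  change γ (stdSimplexHomeomorphUnitInterval (stdSimplex.map (0 : Fin 2).succAbove s)) = y
  rw [hs]
  exact (congrArg γ stdSimplexHomeomorphUnitInterval_one).trans γ.target

theorem face_one_ofPath {x y : X} (γ : Path x y) : face 1 (ofPath γ) = point x := by
  ext s
  have hs : stdSimplex.map (1 : Fin 2).succAbove s = stdSimplex.vertex (S := ℝ) 0 := by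
    rw [Subsingleton.elim s (stdSimplex.vertex 0), stdSimplex.map_vertex]; rfl
  change γ (stdSimplexHomeomorphUnitInterval (stdSimplex.map (1 : Fin 2).succAbove s)) = x
  rw [hs]
  exact (congrArg γ stdSimplexHomeomorphUnitInterval_zero).trans γ.source

end SingularSimplex

/-- Singular `n`-cochains of `X` with values in `A`, as functions on the singular `n`-simplices. -/
abbrev SingularCochain (n : ℕ) (X : Type u) [TopologicalSpace X] (A : Type w) : Type (max u w) :=
  SingularSimplex n X → A

namespace SingularCochain

variable {X : Type u} [TopologicalSpace X] {A : Type w} [AddCommGroup A]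

/-- The singular coboundary `(δα)(σ) = ∑ᵢ (-1)ⁱ α(∂ᵢσ)`. -/
def coboundary (n : ℕ) (X : Type u) [TopologicalSpace X] (A : Type w) [AddCommGroup A] :
    SingularCochain n X A →+ SingularCochain (n + 1) X A where
  toFun α σ := ∑ i : Fin (n + 2), (-1 : ℤ) ^ (i : ℕ) • α (SingularSimplex.face i σ)
  map_zero' := by ext σ; simp
  map_add' α β := by ext σ; simp [smul_add, Finset.sum_add_distrib]

/-- The pullback `(f^*α)(σ) = α(f ∘ σ)`. -/
def pullback (n : ℕ) (A : Type w) [AddCommGroup A] (f : C(X, X)) :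
    SingularCochain n X A →+ SingularCochain n X A where
  toFun α σ := α (f.comp σ)
  map_zero' := rfl
  map_add' _ _ := rfl

theorem coboundary_pullback (n : ℕ) (f : C(X, X)) (α : SingularCochain n X A) :
    coboundary n X A (pullback n A f α) = pullback (n + 1) A f (coboundary n X A α) := rfl

/-- The evaluation of an exact cochain on a path. -/
theorem coboundary_ofPath (κ : SingularCochain 0 X A) {x y : X} (γ : Path x y) :
    coboundary 0 X A κ (SingularSimplex.ofPath γ) =
      κ (SingularSimplex.point y) - κ (SingularSimplex.point x) := by
  change (∑ i : Fin 2, (-1 : ℤ) ^ (i : ℕ) •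
    κ (SingularSimplex.face i (SingularSimplex.ofPath γ))) = _
  rw [Fin.sum_univ_two, SingularSimplex.face_zero_ofPath, SingularSimplex.face_one_ofPath]
  simp [sub_eq_add_neg]

theorem coboundary_one_coboundary_zero (κ : SingularCochain 0 X A) :
    coboundary 1 X A (coboundary 0 X A κ) = 0 := by
  ext σ
  change (∑ i : Fin 3, (-1 : ℤ) ^ (i : ℕ) • ∑ j : Fin 2, (-1 : ℤ) ^ (j : ℕ) •
    κ (SingularSimplex.face j (SingularSimplex.face i σ))) = 0
  have key : ∀ (i i' : Fin 3) (j j' : Fin 2),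
      i.succAbove ∘ j.succAbove = i'.succAbove ∘ j'.succAbove →
      SingularSimplex.face j (SingularSimplex.face i σ) =
        SingularSimplex.face j' (SingularSimplex.face i' σ) := by
    intro i i' j j' h
    ext s
    change σ (stdSimplex.map i.succAbove (stdSimplex.map j.succAbove s)) =
      σ (stdSimplex.map i'.succAbove (stdSimplex.map j'.succAbove s))
    rw [stdSimplex.map_comp_apply, stdSimplex.map_comp_apply, h]
  rw [Fin.sum_univ_three, Fin.sum_univ_two, Fin.sum_univ_two, Fin.sum_univ_two,
    key 1 0 0 0 (by decide), key 2 0 0 1 (by decide), key 2 1 1 1 (by decide)]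
  simp
  abel

end SingularCochain

/-- Singular `1`-cocycles `Z¹(X; A)`. -/
abbrev SingularZ1 (X : Type u) [TopologicalSpace X] (A : Type w) [AddCommGroup A] :
    AddSubgroup (SingularCochain 1 X A) :=
  (SingularCochain.coboundary 1 X A).ker

/-- Singular `1`-coboundaries `B¹(X; A)`, inside the `1`-cocycles. -/
abbrev SingularB1 (X : Type u) [TopologicalSpace X] (A : Type w) [AddCommGroup A] :
    AddSubgroup (SingularZ1 X A) :=
  (SingularCochain.coboundary 0 X A).range.addSubgroupOf (SingularZ1 X A)

/-- The first singular cohomology group `H¹(X; A)`. -/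
abbrev SingularH1 (X : Type u) [TopologicalSpace X] (A : Type w) [AddCommGroup A] :
    Type (max u w) :=
  SingularZ1 X A ⧸ SingularB1 X A

section Pullback

variable {X : Type u} [TopologicalSpace X] (A : Type w) [AddCommGroup A]

/-- The pullback of singular `1`-cocycles. -/
def SingularZ1.pullback (f : C(X, X)) : SingularZ1 X A →+ SingularZ1 X A :=
  ((SingularCochain.pullback 1 A f).comp (SingularZ1 X A).subtype).codRestrict _ (by
    intro α
    have h : SingularCochain.coboundary 1 X A α = 0 := α.2
    change SingularCochain.coboundary 1 X A (SingularCochain.pullback 1 A f α) = 0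
    rw [SingularCochain.coboundary_pullback, h, map_zero])

/-- The map `f^* : H¹(X; A) → H¹(X; A)` induced by a continuous map. -/
def SingularH1.pullback (f : C(X, X)) : SingularH1 X A →+ SingularH1 X A :=
  QuotientAddGroup.map _ _ (SingularZ1.pullback A f) (by
    rintro α ⟨κ, hκ⟩
    refine ⟨SingularCochain.pullback 0 A f κ, ?_⟩
    have hκ' : SingularCochain.coboundary 0 X A κ = α := hκ
    rw [SingularCochain.coboundary_pullback, hκ']
    rfl)

theorem SingularH1.pullback_comp (f g : C(X, X)) (a : SingularH1 X A) :
    SingularH1.pullback A (f.comp g) a = SingularH1.pullback A g (SingularH1.pullback A f a) := by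
  induction a using QuotientAddGroup.induction_on with
  | H α => rfl

theorem SingularH1.pullback_id (a : SingularH1 X A) :
    SingularH1.pullback A (ContinuousMap.id X) a = a := by
  induction a using QuotientAddGroup.induction_on with
  | H α => rfl

end Pullback

/-! ### Homeomorphisms preserving a class -/

/-- The group `Homeo(X, a)` of homeomorphisms `f` of `X` with `f^* a = a`; the product is the
composition. -/
def HomeoPreserving {X : Type u} [TopologicalSpace X] {A : Type w} [AddCommGroup A]
    (a : SingularH1 X A) : Subgroup (X ≃ₜ X) where
  carrier := {f | SingularH1.pullback A (f : C(X, X)) a = a}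
  one_mem' := SingularH1.pullback_id A a
  mul_mem' {f g} hf hg := by
    change SingularH1.pullback A ((f : C(X, X)).comp (g : C(X, X))) a = a
    rw [SingularH1.pullback_comp, hf, hg]
  inv_mem' {f} hf := by
    have hf' : SingularH1.pullback A (f : C(X, X)) a = a := hf
    change SingularH1.pullback A (f.symm : C(X, X)) a = a
    have h : (f : C(X, X)).comp (f.symm : C(X, X)) = ContinuousMap.id X := by
      ext x; simp
    calc SingularH1.pullback A (f.symm : C(X, X)) a
        = SingularH1.pullback A (f.symm : C(X, X)) (SingularH1.pullback A (f : C(X, X)) a) := by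
          rw [hf']
      _ = a := by rw [← SingularH1.pullback_comp, h, SingularH1.pullback_id]

/-! ### Second cohomology of a discrete group with trivial coefficients -/

/-- Inhomogeneous `2`-cocycles of the (discrete) group `G` with trivial coefficients `A`. -/
def GroupZ2 (G : Type v) [Group G] (A : Type w) [AddCommGroup A] :
    AddSubgroup (G → G → A) where
  carrier := {c | ∀ g h k : G, c h k - c (g * h) k + c g (h * k) - c g h = 0}
  zero_mem' := by intro g h k; simp
  add_mem' {c d} hc hd := by
    intro g h k
    have h1 := hc g h k
    have h2 := hd g h k
    calc _ = (c h k - c (g * h) k + c g (h * k) - c g h)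
          + (d h k - d (g * h) k + d g (h * k) - d g h) := by
            simp only [Pi.add_apply]; abel
      _ = 0 := by rw [h1, h2, add_zero]
  neg_mem' {c} hc := by
    intro g h k
    have h1 := hc g h k
    calc _ = -(c h k - c (g * h) k + c g (h * k) - c g h) := by
            simp only [Pi.neg_apply]; abel
      _ = 0 := by rw [h1, neg_zero]

/-- The coboundary `(δb)(g, h) = b(h) - b(gh) + b(g)` of an inhomogeneous `1`-cochain. -/
def groupCoboundary1 (G : Type v) [Group G] (A : Type w) [AddCommGroup A] :
    (G → A) →+ GroupZ2 G A where
  toFun b := ⟨fun g h => b h - b (g * h) + b g, by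
    intro g h k
    simp only [mul_assoc]
    abel⟩
  map_zero' := by ext g h; simp
  map_add' b c := by
    ext g h
    simp only [Pi.add_apply, AddSubgroup.coe_add]
    abel

/-- The second cohomology group `H²(BG^δ; A)` of the discrete group underlying `G`, with trivial
coefficients. -/
abbrev GroupH2 (G : Type v) [Group G] (A : Type w) [AddCommGroup A] : Type (max v w) :=
  GroupZ2 G A ⧸ (groupCoboundary1 G A).range

/-- The pullback of group `2`-cocycles under a homomorphism. -/
def GroupZ2.pullback {G : Type v} [Group G] {H : Type u} [Group H] (A : Type w) [AddCommGroup A]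
    (φ : G →* H) : GroupZ2 H A →+ GroupZ2 G A where
  toFun c := ⟨fun g h => c.1 (φ g) (φ h), by
    intro g h k
    have := c.2 (φ g) (φ h) (φ k)
    simpa only [map_mul] using this⟩
  map_zero' := rfl
  map_add' _ _ := rfl

/-- The map `φ^* : H²(BH^δ; A) → H²(BG^δ; A)` induced by a homomorphism `φ : G → H`. -/
def GroupH2.pullback {G : Type v} [Group G] {H : Type u} [Group H] (A : Type w) [AddCommGroup A]
    (φ : G →* H) : GroupH2 H A →+ GroupH2 G A :=
  QuotientAddGroup.map _ _ (GroupZ2.pullback A φ) (by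
    rintro c ⟨b, rfl⟩
    refine ⟨fun g => b (φ g), ?_⟩
    ext g h
    change b (φ h) - b (φ (g * h)) + b (φ g) = b (φ h) - b (φ g * φ h) + b (φ g)
    rw [map_mul])

/-! ### The two-cocycle on `Homeo(X, a)` -/

section Cocycle

variable {X : Type u} [TopologicalSpace X] {A : Type w} [AddCommGroup A]

/-- If `g` preserves the class of `α`, then `g^*α - α` is exact. -/
theorem HomeoPreserving.exists_primitive {a : SingularH1 X A} {α : SingularZ1 X A}
    (hα : (QuotientAddGroup.mk α : SingularH1 X A) = a) (g : HomeoPreserving a) :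
    ∃ κ : SingularCochain 0 X A, SingularCochain.coboundary 0 X A κ =
      SingularCochain.pullback 1 A ((g : X ≃ₜ X) : C(X, X)) α.1 - α.1 := by
  subst hα
  have h := g.2
  obtain ⟨κ, hκ⟩ := QuotientAddGroup.eq.mp h.symm
  refine ⟨κ, hκ.trans ?_⟩
  rw [sub_eq_neg_add]
  rfl

variable [PathConnectedSpace X]

/-- `𝔊_{x,α}(g, h) = ∫_γ (g^*α - α)`, where `γ` is a path from `x` to `h x`. -/
def homeoCocycleFun (x : X) (α : SingularZ1 X A) (g h : X ≃ₜ X) : A :=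
  (SingularCochain.pullback 1 A (g : C(X, X)) α.1 - α.1)
    (SingularSimplex.ofPath (PathConnectedSpace.somePath x (h x)))

/-- Every path from `x` to `h x` computes the same value. -/
theorem homeoCocycleFun_eq {a : SingularH1 X A} (x : X) {α : SingularZ1 X A}
    (hα : (QuotientAddGroup.mk α : SingularH1 X A) = a) (g : HomeoPreserving a) (h : X ≃ₜ X)
    (γ : Path x (h x)) :
    homeoCocycleFun x α g h =
      (SingularCochain.pullback 1 A ((g : X ≃ₜ X) : C(X, X)) α.1 - α.1)
        (SingularSimplex.ofPath γ) := by
  obtain ⟨κ, hκ⟩ := HomeoPreserving.exists_primitive hα g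
  unfold homeoCocycleFun
  rw [← hκ, SingularCochain.coboundary_ofPath, SingularCochain.coboundary_ofPath]

/-- The two-cocycle `𝔊_{x,α}` on `Homeo(X, a)`, for a singular cocycle `α` representing `a`. -/
def homeoCocycle {a : SingularH1 X A} (x : X) (α : SingularZ1 X A)
    (hα : (QuotientAddGroup.mk α : SingularH1 X A) = a) : GroupZ2 (HomeoPreserving a) A :=
  ⟨fun g h => homeoCocycleFun x α g h, by
    intro g h k
    obtain ⟨κg, hg⟩ := HomeoPreserving.exists_primitive hα g
    obtain ⟨κh, hh⟩ := HomeoPreserving.exists_primitive hα h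
    let κ : SingularCochain 0 X A :=
      SingularCochain.pullback 0 A ((h : X ≃ₜ X) : C(X, X)) κg + κh
    have hgh : SingularCochain.coboundary 0 X A κ =
        SingularCochain.pullback 1 A (((g * h : HomeoPreserving a) : X ≃ₜ X) : C(X, X)) α.1
          - α.1 := by
      have e : SingularCochain.pullback 1 A
          (((g * h : HomeoPreserving a) : X ≃ₜ X) : C(X, X)) α.1 =
          SingularCochain.pullback 1 A ((h : X ≃ₜ X) : C(X, X))
            (SingularCochain.pullback 1 A ((g : X ≃ₜ X) : C(X, X)) α.1) := rfl
      rw [map_add, SingularCochain.coboundary_pullback, hg, hh, e, map_sub]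
      abel
    simp only [homeoCocycleFun]
    rw [← hg, ← hh, ← hgh]
    simp only [SingularCochain.coboundary_ofPath]
    have e1 : ∀ y : X, κ (SingularSimplex.point y) =
        κg (SingularSimplex.point ((h : X ≃ₜ X) y)) + κh (SingularSimplex.point y) :=
      fun _ => rfl
    have e2 : ((h * k : HomeoPreserving a) : X ≃ₜ X) x = (h : X ≃ₜ X) ((k : X ≃ₜ X) x) := rfl
    rw [e1, e1, e2]
    abel⟩

/-- The class `[𝔊] ∈ H²(B Homeo(X, a)^δ; A)` of the two-cocycle `𝔊_{x,α}`. -/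
def homeoClass {a : SingularH1 X A} (x : X) (α : SingularZ1 X A)
    (hα : (QuotientAddGroup.mk α : SingularH1 X A) = a) : GroupH2 (HomeoPreserving a) A :=
  QuotientAddGroup.mk (homeoCocycle x α hα)

end Cocycle

/-! ### Universal covers and amenable groups -/

/-- `X` admits a universal cover, that is, a simply connected covering space. -/
def AdmitsUniversalCover (X : Type u) [TopologicalSpace X] : Prop :=
  ∃ (E : Type u) (_ : TopologicalSpace E) (p : E → X),
    SimplyConnectedSpace E ∧ IsCoveringMap p ∧ Function.Surjective p

/-- A topological group `G` is amenable if every (jointly) continuous affine action of `G` on a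
non-empty compact convex subset of a Hausdorff locally convex real topological vector space has a
fixed point. It suffices to test vector spaces in the universe of `G`, because the weak-* dual of
the space of bounded uniformly continuous functions on `G` is one of them. -/
def IsAmenableGroup (G : Type v) [Group G] [TopologicalSpace G] : Prop :=
  ∀ (E : Type v) [AddCommGroup E] [Module ℝ E] [TopologicalSpace E] [IsTopologicalAddGroup E]
    [ContinuousSMul ℝ E] [LocallyConvexSpace ℝ E] [T2Space E] (K : Set E),
    K.Nonempty → IsCompact K → Convex ℝ K →
    ∀ [MulAction G K] [ContinuousSMul G K],
      (∀ (g : G) (y z m : K) (s t : ℝ), 0 ≤ s → 0 ≤ t → s + t = 1 →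
        (m : E) = s • (y : E) + t • (z : E) →
          ((g • m : K) : E) = s • ((g • y : K) : E) + t • ((g • z : K) : E)) →
      ∃ y : K, ∀ g : G, g • y = y

end

/-! For each `g` the exact cochain `g^*α - α` has a primitive `k_g`, unique up to a constant because
`X` is path-connected, and `𝔊(g, h) = k_g(h x) - k_g(x)`. If the constants can be chosen so that
`k_{gh} = k_g ∘ h + k_h`, then `𝔊` is the coboundary of `g ↦ -k_g(x)`
(`pullback_homeoClass_eq_zero`). Normalising every `k_g` to have mean zero for an invariant measure
would achieve this, but `α` is an arbitrary cochain and `k_g` need not be measurable.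

The remedy is a function `κ` such that `α - δκ` is small on short paths
(`SingularZ1.exists_correction`). Local primitives of `α` come from the simply connected cover, and
`κ` glues them by a partition of unity. Then `c_g = k_g - κ ∘ g + κ` is continuous, and it satisfies
the same relations as `k_g` since the `κ` terms telescope.

Amenability, applied to the means on a space of functions on `G`, gives an invariant mean;
restricted to an orbit it is an invariant positive functional `Λ` on `C(X, ℝ)`. Riesz–Markov turns
`Λ` into the measure, and subtracting `Λ(c_g)` from `k_g` fixes the constants. -/

open Set Topology Filter

/-! ### Values of singular cocycles on paths -/

namespace stdSimplex

/-- The 2-simplices built below are formulas in `s 1` and `s 2` alone, so only these two coordinates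
of each face are needed. -/
theorem map_succAbove_apply (i k : Fin 3) (s : stdSimplex ℝ (Fin 2)) :
    map i.succAbove s k =
      (if i.succAbove 0 = k then s 0 else 0) + (if i.succAbove 1 = k then s 1 else 0) := by
  change (FunOnFinite.linearMap ℝ ℝ i.succAbove s.1) k = _
  rw [FunOnFinite.linearMap_apply_apply, Finset.sum_filter, Fin.sum_univ_two]
  rfl

theorem map_succAbove_zero_one (s : stdSimplex ℝ (Fin 2)) :
    map (0 : Fin 3).succAbove s 1 = s 0 := by
  rw [map_succAbove_apply, if_pos (by decide), if_neg (by decide), add_zero]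

theorem map_succAbove_zero_two (s : stdSimplex ℝ (Fin 2)) :
    map (0 : Fin 3).succAbove s 2 = s 1 := by
  rw [map_succAbove_apply, if_neg (by decide), if_pos (by decide), zero_add]

theorem map_succAbove_one_one (s : stdSimplex ℝ (Fin 2)) :
    map (1 : Fin 3).succAbove s 1 = 0 := by
  rw [map_succAbove_apply, if_neg (by decide), if_neg (by decide), zero_add]

theorem map_succAbove_one_two (s : stdSimplex ℝ (Fin 2)) :
    map (1 : Fin 3).succAbove s 2 = s 1 := by
  rw [map_succAbove_apply, if_neg (by decide), if_pos (by decide), zero_add]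

theorem map_succAbove_two_one (s : stdSimplex ℝ (Fin 2)) :
    map (2 : Fin 3).succAbove s 1 = s 1 := by
  rw [map_succAbove_apply, if_neg (by decide), if_pos (by decide), zero_add]

theorem map_succAbove_two_two (s : stdSimplex ℝ (Fin 2)) :
    map (2 : Fin 3).succAbove s 2 = 0 := by
  rw [map_succAbove_apply, if_neg (by decide), if_neg (by decide), zero_add]

theorem coord_zero_add_one (s : stdSimplex ℝ (Fin 2)) : s 0 + s 1 = 1 := by
  have := s.2.2
  rwa [Fin.sum_univ_two] at this

end stdSimplex

theorem stdSimplex.continuous_coord {n : ℕ} (i : Fin n) :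
    Continuous fun s : stdSimplex ℝ (Fin n) => s.1 i :=
  (continuous_apply i).comp continuous_subtype_val

namespace SingularZ1

variable {X : Type u} [TopologicalSpace X] {A : Type w} [AddCommGroup A]

theorem apply_triangle (α : SingularZ1 X A) (σ : SingularSimplex 2 X) :
    α.1 (SingularSimplex.face 1 σ) =
      α.1 (SingularSimplex.face 2 σ) + α.1 (SingularSimplex.face 0 σ) := by
  have h : SingularCochain.coboundary 1 X A α.1 σ = 0 := congrFun α.2 σ
  change (∑ i : Fin 3, (-1 : ℤ) ^ (i : ℕ) • α.1 (SingularSimplex.face i σ)) = 0 at h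
  rw [Fin.sum_univ_three] at h
  simp only [Fin.val_zero, pow_zero, one_smul, Fin.val_one, pow_one, neg_smul, Fin.val_two,
    even_two, Even.neg_pow, one_pow] at h
  rw [← sub_eq_zero, ← neg_eq_zero, ← h]
  abel

/-- The value of a singular cocycle on a path. -/
def onPath (α : SingularZ1 X A) {x y : X} (γ : Path x y) : A :=
  α.1 (SingularSimplex.ofPath γ)

/-- The form in which closedness is used: an additivity statement reduces to exhibiting one
2-simplex with edges `γ` (vertices 0, 1), `δ` (1, 2) and `η` (0, 2). -/
theorem apply_triangle_eq (α : SingularZ1 X A) {x y z : X} (Φ : C(stdSimplex ℝ (Fin 3), X))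
    (γ : Path x y) (δ : Path y z) (η : Path x z)
    (h₂ : ∀ s : stdSimplex ℝ (Fin 2),
      Φ (stdSimplex.map (2 : Fin 3).succAbove s) = γ (stdSimplexHomeomorphUnitInterval s))
    (h₀ : ∀ s : stdSimplex ℝ (Fin 2),
      Φ (stdSimplex.map (0 : Fin 3).succAbove s) = δ (stdSimplexHomeomorphUnitInterval s))
    (h₁ : ∀ s : stdSimplex ℝ (Fin 2),
      Φ (stdSimplex.map (1 : Fin 3).succAbove s) = η (stdSimplexHomeomorphUnitInterval s)) :
    onPath α η = onPath α γ + onPath α δ := by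
  have e₂ : SingularSimplex.face 2 Φ = SingularSimplex.ofPath γ := ContinuousMap.ext h₂
  have e₀ : SingularSimplex.face 0 Φ = SingularSimplex.ofPath δ := ContinuousMap.ext h₀
  have e₁ : SingularSimplex.face 1 Φ = SingularSimplex.ofPath η := ContinuousMap.ext h₁
  have := apply_triangle α Φ
  rwa [e₀, e₁, e₂] at this

theorem onPath_refl (α : SingularZ1 X A) (x : X) : onPath α (Path.refl x) = 0 := by
  simpa using apply_triangle_eq α (ContinuousMap.const _ x) (Path.refl x) (Path.refl x)
    (Path.refl x) (fun _ => rfl) (fun _ => rfl) (fun _ => rfl)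

theorem onPath_trans (α : SingularZ1 X A) {x y z : X} (γ : Path x y) (δ : Path y z) :
    onPath α (γ.trans δ) = onPath α γ + onPath α δ := by
  -- The affine map of the triangle onto the unit interval with vertices going to 0, 1/2, 1,
  -- followed by the concatenated path; `extend` avoids carrying a proof that the parameter lies in
  -- the interval.
  let Φ : C(stdSimplex ℝ (Fin 3), X) :=
    ⟨fun s => (γ.trans δ).extend (s.1 1 / 2 + s.1 2), by
      exact (γ.trans δ).continuous_extend.comp
        (((stdSimplex.continuous_coord 1).div_const 2).add (stdSimplex.continuous_coord 2))⟩
  have hΦ : ∀ (i : Fin 2 → Fin 3) s, Φ (stdSimplex.map i s) = (γ.trans δ).extend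
    (stdSimplex.map i s 1 / 2 + stdSimplex.map i s 2) := fun _ _ => rfl
  have hI : ∀ s : stdSimplex ℝ (Fin 2), (stdSimplexHomeomorphUnitInterval s : ℝ) = s 1 :=
    fun _ => rfl
  refine apply_triangle_eq α Φ γ δ (γ.trans δ) ?_ ?_ ?_ <;> intro s <;> rw [hΦ]
  · rw [stdSimplex.map_succAbove_two_one, stdSimplex.map_succAbove_two_two, add_zero, ← hI]
    set t := stdSimplexHomeomorphUnitInterval s
    have h1 := t.2.1
    have h2 := t.2.2
    have hm : (t : ℝ) / 2 ∈ unitInterval := ⟨by linarith, by linarith⟩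
    rw [Path.extend_apply _ hm, Path.trans_apply, dif_pos (by simp only; linarith)]
    congr 1
    ext
    simp only
    ring
  · rw [stdSimplex.map_succAbove_zero_one, stdSimplex.map_succAbove_zero_two,
      eq_sub_of_add_eq (stdSimplex.coord_zero_add_one s), ← hI]
    set t := stdSimplexHomeomorphUnitInterval s
    have h1 := t.2.1
    have h2 := t.2.2
    have hm : (1 - (t : ℝ)) / 2 + t ∈ unitInterval := ⟨by linarith, by linarith⟩
    rw [Path.extend_apply _ hm, Path.trans_apply]
    split_ifs with h
    · simp only at h
      -- The edge `δ` meets the first half of the concatenation only at its initial point, where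
      -- both formulas give `y`.
      have ht : t = 0 := by ext; simp only [Icc.coe_zero]; linarith
      refine Eq.trans ?_ (show y = δ t by rw [ht, δ.source])
      convert γ.target using 2
      ext
      simp [ht]
    · congr 1
      ext
      simp only
      ring
  · rw [stdSimplex.map_succAbove_one_one, stdSimplex.map_succAbove_one_two, zero_div, zero_add,
      ← hI, Path.extend_apply _ (stdSimplexHomeomorphUnitInterval s).2]

/-- The square of the homotopy is cut along its diagonal. Each triangle has a constant edge, on
which `α` vanishes, so `γ` and `δ` both have the value of the diagonal. -/
theorem onPath_eq_of_homotopic (α : SingularZ1 X A) {x y : X} {γ δ : Path x y}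
    (h : γ.Homotopic δ) : onPath α γ = onPath α δ := by
  obtain ⟨H⟩ := h
  have hI : ∀ s : stdSimplex ℝ (Fin 2), (stdSimplexHomeomorphUnitInterval s : ℝ) = s 1 :=
    fun _ => rfl
  let p : ℝ → unitInterval := projIcc 0 1 zero_le_one
  have hp : Continuous p := continuous_projIcc
  have hp0 : p 0 = 0 := projIcc_left _
  have hp1 : p 1 = 1 := projIcc_right _
  have hpI : ∀ t : unitInterval, p t = t := fun t => projIcc_val _ t
  let diag : Path x y :=
    { toFun := fun t => H (t, t)
      continuous_toFun := by fun_prop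
      source' := by simp
      target' := by simp }
  let Φ : C(stdSimplex ℝ (Fin 3), X) := ⟨fun s => H (p (s.1 2), p (s.1 1 + s.1 2)),
    H.continuous.comp ((hp.comp (stdSimplex.continuous_coord 2)).prodMk (hp.comp ((stdSimplex.continuous_coord 1).add
      (stdSimplex.continuous_coord 2))))⟩
  have hΦ : ∀ (i : Fin 2 → Fin 3) s, Φ (stdSimplex.map i s) =
    H (p (stdSimplex.map i s 2), p (stdSimplex.map i s 1 + stdSimplex.map i s 2)) := fun _ _ => rfl
  let Ψ : C(stdSimplex ℝ (Fin 3), X) := ⟨fun s => H (p (s.1 1 + s.1 2), p (s.1 2)),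
    H.continuous.comp ((hp.comp ((stdSimplex.continuous_coord 1).add (stdSimplex.continuous_coord 2))).prodMk
      (hp.comp (stdSimplex.continuous_coord 2)))⟩
  have hΨ : ∀ (i : Fin 2 → Fin 3) s, Ψ (stdSimplex.map i s) =
    H (p (stdSimplex.map i s 1 + stdSimplex.map i s 2), p (stdSimplex.map i s 2)) := fun _ _ => rfl
  have e1 : onPath α diag = onPath α γ + onPath α (Path.refl y) := by
    refine apply_triangle_eq α Φ _ _ _ ?_ ?_ ?_ <;> intro s <;> rw [hΦ]
    · rw [stdSimplex.map_succAbove_two_one, stdSimplex.map_succAbove_two_two, add_zero, hp0, ← hI,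
        hpI, H.apply_zero]
      rfl
    · rw [stdSimplex.map_succAbove_zero_one, stdSimplex.map_succAbove_zero_two,
        stdSimplex.coord_zero_add_one, hp1, H.target]
      rfl
    · rw [stdSimplex.map_succAbove_one_one, stdSimplex.map_succAbove_one_two, zero_add, ← hI, hpI]
      rfl
  have e2 : onPath α diag = onPath α (Path.refl x) + onPath α δ := by
    refine apply_triangle_eq α Ψ _ _ _ ?_ ?_ ?_ <;> intro s <;> rw [hΨ]
    · rw [stdSimplex.map_succAbove_two_two, hp0, H.source]
      rfl
    · rw [stdSimplex.map_succAbove_zero_one, stdSimplex.map_succAbove_zero_two,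
        stdSimplex.coord_zero_add_one, hp1, ← hI, hpI, H.apply_one]
      rfl
    · rw [stdSimplex.map_succAbove_one_one, stdSimplex.map_succAbove_one_two, zero_add, ← hI, hpI]
      rfl
  rw [onPath_refl, add_zero] at e1
  rw [onPath_refl, zero_add] at e2
  rw [← e1, e2]

/-- Integrate from a base point; homotopy invariance makes the choice of path irrelevant. -/
theorem exists_primitive_of_simplyConnected [SimplyConnectedSpace X] (α : SingularZ1 X A) :
    ∃ F : X → A, ∀ (x y : X) (γ : Path x y), onPath α γ = F y - F x := by
  obtain ⟨e⟩ := (inferInstance : Nonempty X)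
  refine ⟨fun x => onPath α (PathConnectedSpace.somePath e x), fun x y γ => ?_⟩
  beta_reduce
  rw [onPath_eq_of_homotopic α (SimplyConnectedSpace.paths_homotopic
    (PathConnectedSpace.somePath e y) ((PathConnectedSpace.somePath e x).trans γ)), onPath_trans]
  abel

/-- The pullback of a singular cocycle under a continuous map between two spaces. -/
def comap {E : Type v} [TopologicalSpace E] (p : C(E, X)) (α : SingularZ1 X A) :
    SingularZ1 E A :=
  ⟨fun σ => α.1 (p.comp σ), funext fun σ =>
    (congrFun α.2 (p.comp σ) : SingularCochain.coboundary 1 X A α.1 (p.comp σ) = 0)⟩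

/-- If `X` admits a universal cover, singular cocycles on `X` are locally exact on paths. -/
theorem exists_local_primitive (hX : AdmitsUniversalCover X) (α : SingularZ1 X A) (z : X) :
    ∃ U : Set X, IsOpen U ∧ z ∈ U ∧ ∃ f : X → A, ∀ (x y : X) (γ : Path x y),
      (∀ t, γ t ∈ U) → onPath α γ = f y - f x := by
  obtain ⟨E, _, p, _, hp, hsurj⟩ := hX
  obtain ⟨e, rfl⟩ := hsurj z
  -- Paths in the target of a local inverse lift by composition, so the global primitive on `E`
  -- descends there.
  obtain ⟨φ, he, hφ⟩ := hp.isLocalHomeomorph e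
  obtain ⟨F, hF⟩ := exists_primitive_of_simplyConnected (comap ⟨p, hp.continuous⟩ α)
  refine ⟨φ.target, φ.open_target, hφ ▸ φ.map_source he, fun x => F (φ.symm x),
    fun x y γ hγ => ?_⟩
  let γ' : Path (φ.symm x) (φ.symm y) :=
    { toFun := fun t => φ.symm (γ t)
      continuous_toFun := φ.continuousOn_symm.comp_continuous γ.continuous hγ
      source' := by simp
      target' := by simp }
  rw [← hF _ _ γ']
  change α.1 _ = α.1 _
  refine congrArg α.1 (ContinuousMap.ext fun s => ?_)
  change γ _ = p (φ.symm (γ _))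
  rw [hφ, φ.right_inv (hγ _)]

end SingularZ1

/-! ### Continuity of primitives up to a correction -/

namespace SingularZ1

variable {X : Type u} [TopologicalSpace X]

/-- On a compact Hausdorff space with a universal cover, a real singular cocycle is, up to an exact
one, small on paths in small sets. -/
theorem exists_correction [CompactSpace X] [T2Space X] [LocallyPathConnectedSpace X]
    (hX : AdmitsUniversalCover X) (α : SingularZ1 X ℝ) :
    ∃ κ : X → ℝ, ∀ (z : X) (ε : ℝ), 0 < ε → ∃ U ∈ 𝓝 z, ∀ (x y : X) (γ : Path x y),
      (∀ t, γ t ∈ U) → |onPath α γ - (κ y - κ x)| < ε := by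
  choose U hUo hzU f hf using exists_local_primitive hX α
  obtain ⟨T, hT⟩ := isCompact_univ.elim_finite_subcover U hUo
    (fun z _ => mem_iUnion.2 ⟨z, hzU z⟩)
  obtain ⟨ρ, hρ⟩ := PartitionOfUnity.exists_isSubordinate isClosed_univ (fun i : T => U i)
    (fun i => hUo i) (by simpa [iUnion_subtype] using hT)
  let κ : X → ℝ := fun z => ∑ i : T, ρ i z * f i z
  have hsum : ∀ z, ∑ i : T, ρ i z = 1 := fun z => by
    rw [← finsum_eq_sum_of_fintype]
    exact ρ.sum_eq_one (mem_univ z)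
  -- The `f i` may be wildly discontinuous, but near `z` any two of them that are defined there
  -- differ by a constant, being primitives of the same cocycle on a path-connected set.
  have hκ : ∀ z, ContinuousAt (fun x => κ x - f z x) z := fun z => by
    have e : (fun x => κ x - f z x) = fun x => ∑ i : T, ρ i x * (f i x - f z x) := by
      funext x
      simp only [κ, mul_sub, Finset.sum_sub_distrib, ← Finset.sum_mul, hsum, one_mul]
    rw [e]
    refine tendsto_finsetSum _ fun i _ => ?_
    by_cases hi : z ∈ tsupport (ρ i)
    · have hzi : U i ∩ U z ∈ 𝓝 z :=
        inter_mem ((hUo i).mem_nhds (hρ i hi)) ((hUo z).mem_nhds (hzU z))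
      obtain ⟨W, ⟨hW, hWc⟩, hWU⟩ := (path_connected_basis z).mem_iff.1 hzi
      refine Tendsto.mul (ρ i).continuous.continuousAt ?_
      refine tendsto_const_nhds.congr' ?_
      filter_upwards [hW] with x hx
      obtain ⟨γ, hγ⟩ := hWc.joinedIn z (mem_of_mem_nhds hW) x hx
      have h1 := hf i z x γ fun t => (hWU (hγ t)).1
      have h2 := hf z z x γ fun t => (hWU (hγ t)).2
      linarith
    -- Here `f i` is uncontrolled, but its weight vanishes near `z`.
    · have h0 : (fun x => ρ i x) =ᶠ[𝓝 z] 0 := notMem_tsupport_iff_eventuallyEq.1 hi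
      have hz : ρ i z = 0 := h0.self_of_nhds
      rw [hz, zero_mul]
      refine tendsto_const_nhds.congr' ?_
      filter_upwards [h0] with x hx
      rw [hx, Pi.zero_apply, zero_mul]
  refine ⟨κ, fun z ε hε => ?_⟩
  refine ⟨_, inter_mem ((hUo z).mem_nhds (hzU z))
    ((hκ z).preimage_mem_nhds (Metric.ball_mem_nhds _ (half_pos hε))), fun x y γ hγ => ?_⟩
  -- The error becomes the difference of `κ - f z` at the two ends, each within `ε / 2` of its value
  -- at `z`.
  rw [hf z x y γ fun t => (hγ t).1]
  have hx := (hγ 0).2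
  have hy := (hγ 1).2
  simp only [γ.source, γ.target, mem_preimage, Metric.mem_ball, Real.dist_eq, abs_lt] at hx hy
  rw [abs_lt]
  constructor <;> linarith [hx.1, hx.2, hy.1, hy.2]

/-- If `α - δκ` is small on paths in small sets and `k` is a primitive of `g^*α - α` on paths, then
`k - g^*κ + κ` is continuous. -/
theorem continuous_corrected_primitive [LocallyPathConnectedSpace X] {α : SingularZ1 X ℝ}
    {κ : X → ℝ}
    (hκ : ∀ (z : X) (ε : ℝ), 0 < ε → ∃ U ∈ 𝓝 z, ∀ (x y : X) (γ : Path x y),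
      (∀ t, γ t ∈ U) → |onPath α γ - (κ y - κ x)| < ε)
    (g : C(X, X)) {k : X → ℝ}
    (hk : ∀ (x y : X) (γ : Path x y),
      k y - k x = onPath α (γ.map g.continuous) - onPath α γ) :
    Continuous fun x => k x - κ (g x) + κ x := by
  rw [continuous_iff_continuousAt]
  intro z
  rw [ContinuousAt, Metric.tendsto_nhds]
  intro ε hε
  obtain ⟨U, hU, h1⟩ := hκ z _ (half_pos hε)
  obtain ⟨U', hU', h2⟩ := hκ (g z) _ (half_pos hε)
  obtain ⟨W, ⟨hW, hWc⟩, hWU⟩ := (path_connected_basis z).mem_iff.1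
    (inter_mem hU (g.continuous.continuousAt.preimage_mem_nhds hU'))
  filter_upwards [hW] with x hx
  obtain ⟨γ, hγ⟩ := hWc.joinedIn z (mem_of_mem_nhds hW) x hx
  -- The increment of the corrected primitive along `γ` is the value of `α - δκ` on `g ∘ γ` minus
  -- its value on `γ`.
  have e1 := abs_lt.1 (h1 z x γ fun t => (hWU (hγ t)).1)
  have e2 := abs_lt.1 (h2 _ _ (γ.map g.continuous) fun t => (hWU (hγ t)).2)
  have e3 := hk z x γ
  rw [Real.dist_eq, abs_lt]
  constructor <;> linarith [e1.1, e1.2, e2.1, e2.2]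

end SingularZ1

/-! ### Invariant functionals from amenability -/

open BoundedContinuousFunction

/-- The bounded continuous functions `F` on `G` for which `h ↦ F (h * ·)` is continuous for the
uniform norm, as a subspace. -/
def translationContinuousSubmodule (G : Type v) [Group G] [TopologicalSpace G]
    [IsTopologicalGroup G] : Submodule ℝ (G →ᵇ ℝ) where
  carrier := {F | Continuous fun h : G => F.compContinuous (ContinuousMap.mulLeft h)}
  zero_mem' := continuous_const (y := (0 : G →ᵇ ℝ))
  add_mem' hF hF' := hF.add hF'
  smul_mem' c _ hF := hF.const_smul c

/-- The normed space of bounded continuous functions `F` on `G` for which `h ↦ F (h * ·)` is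
continuous for the uniform norm. -/
def TranslationContinuous (G : Type v) [Group G] [TopologicalSpace G] [IsTopologicalGroup G] :
    Type v :=
  translationContinuousSubmodule G

namespace TranslationContinuous

variable {G : Type v} [Group G] [TopologicalSpace G] [IsTopologicalGroup G]

noncomputable instance : NormedAddCommGroup (TranslationContinuous G) :=
  inferInstanceAs (NormedAddCommGroup (translationContinuousSubmodule G))

noncomputable instance : NormedSpace ℝ (TranslationContinuous G) :=
  inferInstanceAs (NormedSpace ℝ (translationContinuousSubmodule G))

instance : LocallyConvexSpace ℝ (WeakDual ℝ (TranslationContinuous G)) :=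
  (WeakDual.withSeminorms ℝ (TranslationContinuous G)).toLocallyConvexSpace

@[ext]
theorem ext {F F' : TranslationContinuous G} (h : ∀ g, F.1 g = F'.1 g) : F = F' :=
  Subtype.ext (BoundedContinuousFunction.ext h)

theorem abs_apply_le_norm (F : TranslationContinuous G) (g : G) : |F.1 g| ≤ ‖F‖ :=
  F.1.norm_coe_le_norm g

/-- The translate `F (h * ·)` of a function `F`. -/
def translateFun (h : G) (F : TranslationContinuous G) : TranslationContinuous G :=
  ⟨F.1.compContinuous (ContinuousMap.mulLeft h), by
    have e : (fun k : G => (F.1.compContinuous (ContinuousMap.mulLeft h)).compContinuous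
        (ContinuousMap.mulLeft k)) =
        fun k : G => F.1.compContinuous (ContinuousMap.mulLeft (h * k)) := by
      funext k
      ext g
      exact congrArg F.1 (mul_assoc h k g).symm
    change Continuous _
    rw [e]
    exact Continuous.comp (g := fun k : G => F.1.compContinuous (ContinuousMap.mulLeft k))
      F.2 (continuous_const_mul h)⟩

/-- The translation of functions by a group element. -/
noncomputable def translate (h : G) : TranslationContinuous G →L[ℝ] TranslationContinuous G :=
  LinearMap.mkContinuous
    { toFun := translateFun h
      map_add' _ _ := rfl
      map_smul' _ _ := rfl }
    1 (fun F => by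
      rw [one_mul]
      exact (norm_le (norm_nonneg F)).2 fun g => F.abs_apply_le_norm (h * g))

theorem continuous_translate (F : TranslationContinuous G) :
    Continuous fun h : G => translate h F :=
  Continuous.subtype_mk F.2 _

/-- Translation reverses products, so precomposition with it is a left action on functionals. -/
theorem translate_mul (h k : G) : translate (h * k) = (translate k).comp (translate h) := by
  ext F g
  exact congrArg F.1 (mul_assoc h k g)

theorem translate_one : translate (1 : G) = ContinuousLinearMap.id ℝ _ := by
  ext F g
  exact congrArg F.1 (one_mul g)

/-- The constant function `1`. -/
noncomputable instance : One (TranslationContinuous G) :=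
  ⟨⟨1, continuous_const (y := (1 : G →ᵇ ℝ))⟩⟩

variable (G) in
/-- The means on the space of translation continuous functions. -/
def means : Set (WeakDual ℝ (TranslationContinuous G)) :=
  {m | (∀ F : TranslationContinuous G, (∀ g, 0 ≤ F.1 g) → 0 ≤ m F) ∧ m 1 = 1}

/-- Positivity on `‖F‖ • 1 ± F`. This bound gives compactness of the means by Banach–Alaoglu, and
the uniformity in `m` behind the joint continuity of the action. -/
theorem abs_apply_le {m : WeakDual ℝ (TranslationContinuous G)} (hm : m ∈ means G)
    (F : TranslationContinuous G) : |m F| ≤ ‖F‖ := by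
  have key : ∀ F : TranslationContinuous G, m F ≤ ‖F‖ := fun F => by
    have h := hm.1 (‖F‖ • 1 - F) fun g => by
      change 0 ≤ ‖F‖ * 1 - F.1 g
      rw [mul_one, sub_nonneg]
      exact (le_abs_self _).trans (F.abs_apply_le_norm g)
    rw [map_sub, map_smul, hm.2, smul_eq_mul, mul_one] at h
    linarith
  rw [abs_le]
  have h := key (-F)
  rw [map_neg, norm_neg] at h
  exact ⟨by linarith, key F⟩

theorem means_nonempty : (means G).Nonempty := by
  let ev : TranslationContinuous G →L[ℝ] ℝ :=
    (evalCLM ℝ (1 : G)).comp (translationContinuousSubmodule G).subtypeL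
  exact ⟨StrongDual.toWeakDual ev, fun F hF => hF 1, rfl⟩

theorem isClosed_means : IsClosed (means G) := by
  have h : means G = (⋂ F : TranslationContinuous G, ⋂ (_ : ∀ g, 0 ≤ F.1 g),
      {m : WeakDual ℝ (TranslationContinuous G) | 0 ≤ m F}) ∩ {m | m 1 = 1} := by
    ext m
    simp [means]
  rw [h]
  refine IsClosed.inter (isClosed_iInter fun F => isClosed_iInter fun _ => ?_) ?_
  · exact isClosed_le continuous_const (WeakDual.eval_continuous F)
  · exact isClosed_eq (WeakDual.eval_continuous _) continuous_const

theorem isCompact_means : IsCompact (means G) := by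
  refine (WeakDual.isCompact_closedBall (𝕜 := ℝ) 0 1).of_isClosed_subset isClosed_means ?_
  intro m hm
  rw [mem_preimage, mem_closedBall_zero_iff]
  refine ContinuousLinearMap.opNorm_le_bound _ zero_le_one fun F => ?_
  rw [one_mul]
  exact abs_apply_le hm F

theorem convex_means : Convex ℝ (means G) := by
  intro m hm m' hm' s t hs ht hst
  refine ⟨fun F hF => ?_, ?_⟩
  · exact add_nonneg (mul_nonneg hs (hm.1 F hF)) (mul_nonneg ht (hm'.1 F hF))
  · change s * m 1 + t * m' 1 = 1
    rw [hm.2, hm'.2, mul_one, mul_one, hst]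

/-- The action of `G` on the means. -/
noncomputable instance : MulAction G (means G) where
  smul h m := ⟨StrongDual.toWeakDual ((WeakDual.toStrongDual m.1).comp (translate h)),
    fun F hF => m.2.1 _ fun g => hF (h * g), m.2.2⟩
  one_smul m := by
    refine Subtype.ext (DFunLike.ext _ _ fun F => ?_)
    change m.1 (translate 1 F) = m.1 F
    rw [translate_one]
    rfl
  mul_smul h k m := by
    refine Subtype.ext (DFunLike.ext _ _ fun F => ?_)
    change m.1 (translate (h * k) F) = m.1 (translate k (translate h F))
    rw [translate_mul]
    rfl

/-- Moving `h` changes the value by at most `‖translate h F - translate h₀ F‖`, uniformly in the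
mean; this is small precisely because `F` is translation continuous. Moving the mean is weak-*
continuity. -/
instance : ContinuousSMul G (means G) where
  continuous_smul := by
    refine Continuous.subtype_mk (WeakDual.continuous_of_continuous_eval fun F => ?_) _
    change Continuous fun q : G × means G => q.2.1 (translate q.1 F)
    rw [continuous_iff_continuousAt]
    rintro ⟨h₀, m₀⟩
    have e : (fun q : G × means G => q.2.1 (translate q.1 F)) = fun q =>
        q.2.1 (translate q.1 F - translate h₀ F) + q.2.1 (translate h₀ F) := by
      funext q
      rw [map_sub, sub_add_cancel]
    change Tendsto _ _ (𝓝 (m₀.1 (translate h₀ F)))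
    rw [e, ← zero_add (m₀.1 (translate h₀ F))]
    refine Tendsto.add (squeeze_zero_norm (f := fun q : G × means G =>
      q.2.1 (translate q.1 F - translate h₀ F)) (a := fun q : G × means G =>
      ‖translate q.1 F - translate h₀ F‖) (fun q => abs_apply_le q.2.2 _) ?_) ?_
    · have : Continuous fun q : G × means G => ‖translate q.1 F - translate h₀ F‖ :=
        (((continuous_translate F).comp continuous_fst).sub continuous_const).norm
      have h := this.tendsto (h₀, m₀)
      simpa only [sub_self, norm_zero] using h
    · exact (((WeakDual.eval_continuous (translate h₀ F)).comp continuous_subtype_val).comp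
        continuous_snd).tendsto (h₀, m₀)

/-- An amenable group has an invariant mean on its translation continuous functions. -/
theorem exists_invariant_mean (hG : IsAmenableGroup G) :
    ∃ m ∈ means G, ∀ (h : G) (F : TranslationContinuous G), m (translate h F) = m F := by
  obtain ⟨m, hm⟩ := hG (WeakDual ℝ (TranslationContinuous G)) (means G) means_nonempty
    isCompact_means convex_means (by
      intro g y z m s t _ _ _ h
      refine DFunLike.ext _ _ fun F => ?_
      exact congrArg (fun n : WeakDual ℝ (TranslationContinuous G) => n (translate g F)) h)
  exact ⟨m, m.2, fun h F => congrArg (fun n : means G => n.1 F) (hm h)⟩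

end TranslationContinuous

/-! ### From an invariant mean on the group to an invariant measure on the space -/

section InvariantFunctional

variable {X : Type u} [TopologicalSpace X] [CompactSpace X]
variable {G : Type v} [Group G] [TopologicalSpace G] [IsTopologicalGroup G]

/-- An amenable group acting continuously on a non-empty compact space leaves a positive
normalised functional on the continuous functions invariant. -/
theorem exists_invariant_functional [Nonempty X] (hG : IsAmenableGroup G) (ρ : G →* (X ≃ₜ X))
    (hρ : Continuous fun p : G × X => ρ p.1 p.2) :
    ∃ Λ : C(X, ℝ) →ₗ[ℝ] ℝ, (∀ f : C(X, ℝ), 0 ≤ f → 0 ≤ Λ f) ∧ Λ 1 = 1 ∧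
      ∀ (g : G) (f : C(X, ℝ)), Λ (f.comp (ρ g : C(X, X))) = Λ f := by
  obtain ⟨m, hm, hinv⟩ := TranslationContinuous.exists_invariant_mean hG
  obtain ⟨x₀⟩ := (inferInstance : Nonempty X)
  let orbit : C(G, X) := ⟨fun g => ρ g x₀, hρ.comp (continuous_id.prodMk continuous_const)⟩
  have hact : Continuous fun g : G => (ρ g : C(X, X)) :=
    (ContinuousMap.curry ⟨_, hρ⟩).continuous
  let T : C(X, ℝ) →ₗ[ℝ] TranslationContinuous G :=
    { toFun f := ⟨(BoundedContinuousFunction.mkOfCompact f).compContinuous orbit, by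
        -- Translating the orbit function of `f` by `h` gives the orbit function of `f ∘ ρ h`, which
        -- depends norm-continuously on `h` because `X` is compact.
        have e : (fun h : G => ((BoundedContinuousFunction.mkOfCompact f).compContinuous
            orbit).compContinuous (ContinuousMap.mulLeft h)) = fun h : G =>
            (BoundedContinuousFunction.mkOfCompact (f.comp (ρ h : C(X, X)))).compContinuous
              orbit := by
          funext h
          ext g
          change f (ρ (h * g) x₀) = f (ρ h (ρ g x₀))
          rw [map_mul]
          rfl
        change Continuous _
        rw [e]
        refine (BoundedContinuousFunction.continuous_compContinuous orbit).comp ?_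
        exact (ContinuousMap.isometryEquivBoundedOfCompact X ℝ).continuous.comp
          (f.continuous_postcomp.comp hact)⟩
      map_add' _ _ := rfl
      map_smul' _ _ := rfl }
  refine ⟨(WeakDual.toStrongDual m).toLinearMap ∘ₗ T, fun f hf => hm.1 _ fun g => hf _, hm.2,
    fun g f => ?_⟩
  have e : T (f.comp (ρ g : C(X, X))) = TranslationContinuous.translate g (T f) := by
    ext h
    change f (ρ g (ρ h x₀)) = f (ρ (g * h) x₀)
    rw [map_mul]
    rfl
  change m (T _) = m (T f)
  rw [e, hinv]

open MeasureTheory in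
/-- A positive normalised functional invariant under homeomorphisms is given by an invariant
probability measure. -/
theorem exists_invariant_measure [T2Space X] [MeasurableSpace X] [BorelSpace X]
    (Λ : C(X, ℝ) →ₗ[ℝ] ℝ) (hpos : ∀ f : C(X, ℝ), 0 ≤ f → 0 ≤ Λ f) (hone : Λ 1 = 1) :
    ∃ μ : Measure X, IsProbabilityMeasure μ ∧ ∀ φ : X ≃ₜ X,
      (∀ f : C(X, ℝ), Λ (f.comp (φ : C(X, X))) = Λ f) → μ.map φ = μ := by
  let Λ' : CompactlySupportedContinuousMap X ℝ →ₚ[ℝ] ℝ :=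
    { toFun f := Λ f.toContinuousMap
      map_add' f g := map_add Λ f.toContinuousMap g.toContinuousMap
      map_smul' c f := map_smul Λ c f.toContinuousMap
      monotone' f g h := by
        change Λ f.toContinuousMap ≤ Λ g.toContinuousMap
        have := hpos (g.toContinuousMap - f.toContinuousMap) fun x => sub_nonneg.2 (h x)
        rwa [map_sub, sub_nonneg] at this }
  have hint : ∀ f : C(X, ℝ), ∫ x, f x ∂(RealRMK.rieszMeasure Λ') = Λ f := fun f =>
    RealRMK.integral_rieszMeasure Λ' ⟨f, HasCompactSupport.of_compactSpace f⟩
  refine ⟨RealRMK.rieszMeasure Λ', ⟨?_⟩, fun φ hφ => ?_⟩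
  · have h := hint 1
    simp only [ContinuousMap.one_apply, integral_const, smul_eq_mul, mul_one, hone] at h
    rwa [measureReal_def, ENNReal.toReal_eq_one_iff] at h
  -- Both measures are regular, so integrals of continuous functions determine them.
  · have : ((RealRMK.rieszMeasure Λ').map φ).Regular := Measure.Regular.map φ
    refine Measure.ext_of_integral_eq_on_compactlySupported fun f => ?_
    refine (integral_map φ.continuous.measurable.aemeasurable
      f.continuous.aestronglyMeasurable).trans ?_
    exact (hint (f.toContinuousMap.comp (φ : C(X, X)))).trans
      ((hφ _).trans (hint f.toContinuousMap).symm)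

end InvariantFunctional

/-! ### Normalised primitives and vanishing of the class -/

section Vanishing

variable {X : Type u} [TopologicalSpace X]

/-- If `g` preserves the class of `α`, the values of `g^*α - α` on paths have a primitive. -/
theorem HomeoPreserving.exists_primitive_onPath {a : SingularH1 X ℝ} {α : SingularZ1 X ℝ}
    (hα : (QuotientAddGroup.mk α : SingularH1 X ℝ) = a) (g : HomeoPreserving a) :
    ∃ k : X → ℝ, ∀ (x y : X) (γ : Path x y), k y - k x =
      SingularZ1.onPath α (γ.map (g : X ≃ₜ X).continuous) - SingularZ1.onPath α γ := by
  obtain ⟨κ, hκ⟩ := HomeoPreserving.exists_primitive hα g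
  refine ⟨fun x => κ (SingularSimplex.point x), fun x y γ => ?_⟩
  rw [← SingularCochain.coboundary_ofPath κ γ, hκ]
  rfl

variable [PathConnectedSpace X] {G : Type v} [Group G]

/-- If primitives of `g^*α - α` can be chosen as a one-cocycle with values in functions, then the
pullback of the class of `𝔊` vanishes. -/
theorem pullback_homeoClass_eq_zero {a : SingularH1 X ℝ} (ψ : G →* HomeoPreserving a)
    (x : X) (α : SingularZ1 X ℝ) (hα : (QuotientAddGroup.mk α : SingularH1 X ℝ) = a)
    (k : G → X → ℝ)
    (hk : ∀ (g : G) (x y : X) (γ : Path x y), k g y - k g x =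
      SingularZ1.onPath α (γ.map (ψ g : X ≃ₜ X).continuous) - SingularZ1.onPath α γ)
    (hmul : ∀ (g h : G) (y : X), k (g * h) y = k g ((ψ h : X ≃ₜ X) y) + k h y) :
    GroupH2.pullback ℝ ψ (homeoClass x α hα) = 0 := by
  refine (QuotientAddGroup.eq_zero_iff (GroupZ2.pullback ℝ ψ (homeoCocycle x α hα))).2 ?_
  -- The sign comes from `k_g(h x) - k_g(x) = k_{gh}(x) - k_h(x) - k_g(x)`.
  refine ⟨fun g => -k g x, ?_⟩
  ext g h
  change -k h x - -k (g * h) x + -k g x =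
    SingularZ1.onPath α ((PathConnectedSpace.somePath x ((ψ h : X ≃ₜ X) x)).map
      (ψ g : X ≃ₜ X).continuous) - SingularZ1.onPath α (PathConnectedSpace.somePath x _)
  rw [← hk, hmul]
  ring

/-- Primitives normalised by an invariant functional form a one-cocycle with values in functions. -/
theorem exists_multiplicative_primitives [LocallyPathConnectedSpace X] {a : SingularH1 X ℝ}
    (ψ : G →* HomeoPreserving a) {α : SingularZ1 X ℝ}
    (hα : (QuotientAddGroup.mk α : SingularH1 X ℝ) = a) {κ : X → ℝ}
    (hκ : ∀ (z : X) (ε : ℝ), 0 < ε → ∃ U ∈ 𝓝 z, ∀ (x y : X) (γ : Path x y),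
      (∀ t, γ t ∈ U) → |SingularZ1.onPath α γ - (κ y - κ x)| < ε)
    (Λ : C(X, ℝ) →ₗ[ℝ] ℝ) (hone : Λ 1 = 1)
    (hinv : ∀ (g : G) (f : C(X, ℝ)), Λ (f.comp ((ψ g : X ≃ₜ X) : C(X, X))) = Λ f) :
    ∃ k : G → X → ℝ, (∀ (g : G) (x y : X) (γ : Path x y), k g y - k g x =
      SingularZ1.onPath α (γ.map (ψ g : X ≃ₜ X).continuous) - SingularZ1.onPath α γ) ∧
      ∀ (g h : G) (y : X), k (g * h) y = k g ((ψ h : X ≃ₜ X) y) + k h y := by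
  choose k₀ hk₀ using fun g : G => HomeoPreserving.exists_primitive_onPath hα (ψ g)
  let c : G → C(X, ℝ) := fun g => ⟨fun x => k₀ g x - κ ((ψ g : X ≃ₜ X) x) + κ x,
    SingularZ1.continuous_corrected_primitive hκ ((ψ g : X ≃ₜ X) : C(X, X)) (hk₀ g)⟩
  have hk : ∀ (g : G) (x y : X) (γ : Path x y), (k₀ g y - Λ (c g)) - (k₀ g x - Λ (c g)) =
      SingularZ1.onPath α (γ.map (ψ g : X ≃ₜ X).continuous) - SingularZ1.onPath α γ :=
    fun g x y γ => by rw [sub_sub_sub_cancel_right, hk₀ g x y γ]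
  have hψ : ∀ (g h : G) (y : X), (ψ (g * h) : X ≃ₜ X) y = (ψ g : X ≃ₜ X) ((ψ h : X ≃ₜ X) y) :=
    fun g h y => by rw [map_mul]; rfl
  refine ⟨fun g x => k₀ g x - Λ (c g), hk, fun g h y => ?_⟩
  -- Both sides are primitives of `(gh)^*α - α`, hence differ by a constant, read off at `y`.
  obtain ⟨d, hd⟩ : ∃ d : ℝ, ∀ z, k₀ (g * h) z = k₀ g ((ψ h : X ≃ₜ X) z) + k₀ h z + d := by
    refine ⟨k₀ (g * h) y - (k₀ g ((ψ h : X ≃ₜ X) y) + k₀ h y), fun z => ?_⟩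
    let γ := PathConnectedSpace.somePath y z
    have e1 := hk₀ (g * h) y z γ
    have e2 := hk₀ g _ _ (γ.map (ψ h : X ≃ₜ X).continuous)
    have e3 := hk₀ h y z γ
    have e4 : SingularZ1.onPath α (γ.map (ψ (g * h) : X ≃ₜ X).continuous) =
        SingularZ1.onPath α ((γ.map (ψ h : X ≃ₜ X).continuous).map
          (ψ g : X ≃ₜ X).continuous) :=
      congrArg α.1 (ContinuousMap.ext fun s => hψ g h _)
    linarith
  -- The correction terms in `κ` telescope, so the continuous functions have the same defect `d`;
  -- applying `Λ` isolates it, and the normalisation cancels it.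
  have hc : c (g * h) = (c g).comp ((ψ h : X ≃ₜ X) : C(X, X)) + c h + d • (1 : C(X, ℝ)) := by
    ext z
    change k₀ (g * h) z - κ ((ψ (g * h) : X ≃ₜ X) z) + κ z =
      (k₀ g ((ψ h : X ≃ₜ X) z) - κ ((ψ g : X ≃ₜ X) ((ψ h : X ≃ₜ X) z)) + κ ((ψ h : X ≃ₜ X) z)) +
        (k₀ h z - κ ((ψ h : X ≃ₜ X) z) + κ z) + d * 1
    rw [hd, hψ]
    ring
  have hΛ : Λ (c (g * h)) = Λ (c g) + Λ (c h) + d := by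
    rw [hc, map_add, map_add, map_smul, hone, hinv, smul_eq_mul, mul_one]
  beta_reduce
  rw [hd, hΛ]
  ring

end Vanishing

theorem mainTheorem10 {X : Type u} [TopologicalSpace X] [CompactSpace X] [T2Space X]
    [PathConnectedSpace X] [LocallyPathConnectedSpace X] (hX : AdmitsUniversalCover X)
    [MeasurableSpace X] [BorelSpace X]
    {G : Type v} [Group G] [TopologicalSpace G] [IsTopologicalGroup G] (hG : IsAmenableGroup G)
    (a : SingularH1 X ℝ) (ψ : G →* HomeoPreserving a)
    (hψ : Continuous fun p : G × X => (ψ p.1 : X ≃ₜ X) p.2) :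
    (∃ μ : MeasureTheory.Measure X, MeasureTheory.IsProbabilityMeasure μ ∧
      ∀ g : G, μ.map (ψ g : X ≃ₜ X) = μ) ∧
    ∀ (x : X) (α : SingularZ1 X ℝ) (hα : (QuotientAddGroup.mk α : SingularH1 X ℝ) = a),
      GroupH2.pullback ℝ ψ (homeoClass x α hα) = 0 := by
  -- The same functional yields both conclusions; the vanishing needs only its linearity,
  -- normalisation and invariance, not the measure.
  obtain ⟨Λ, hpos, hone, hinv⟩ := exists_invariant_functional hG
    ((HomeoPreserving a).subtype.comp ψ) hψ
  refine ⟨?_, fun x α hα => ?_⟩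
  · obtain ⟨μ, hμ, hμinv⟩ := exists_invariant_measure Λ hpos hone
    exact ⟨μ, hμ, fun g => hμinv (ψ g) (hinv g)⟩
  · obtain ⟨κ, hκ⟩ := SingularZ1.exists_correction hX α
    obtain ⟨k, hk, hmul⟩ := exists_multiplicative_primitives ψ hα hκ Λ hone hinv
    exact pullback_homeoClass_eq_zero ψ x α hα k hk hmul
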